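/- Let $b\ge 2$ be an integer and $0<\alpha<1$. Let $\mathbb S^1=\mathbb R/\mathbb Z$ with the arc-length metric $|x-y|=\min_{n\in\mathbb Z}|x-y+n|$. For a Lipschitz function $g\colon\mathbb S^1\to\mathbb R$ put $W_g^{\alpha,b}(x)=\sum_{k=0}^\infty b^{-\alpha k}g(b^kx)$, and let $\mathcal W^{\alpha,b}$ be the set of all functions $W_g^{\alpha,b}$ with $g$ Lipschitz. For a finite collection $\mathcal G=\{g_0,\dots,g_{d-1}\}$ of Lipschitz functions on $\mathbb S^1$ let $\Phi_{\mathcal G}^{\alpha,b}=(W_{g_0}^{\alpha,b},\dots,W_{g_{d-1}}^{\alpha,b})\colon\mathbb S^1\to\mathbb R^d$. A map $\Phi\colon\mathbb S^1\to\mathbb R^d$ is called $\alpha$-bi-Hölder if there are constants $c_1,c_2>0$ such that $c_1\le \|\Phi(x)-\Phi(y)\|_\infty/|x-y|^\alpha\le c_2$ for all $x\ne y$ in $\mathbb S^1$. Then there exist $d$ and $\mathcal G$ as above for which $\Phi_{\mathcal G}^{\alpha,b}$ is $\alpha$-bi-Hölder. Moreover, for every $d$ and every such $\mathcal G=\{g_0,\dots,g_{d-1}\}$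 for which $\Phi=\Phi_{\mathcal G}^{\alpha,b}$ is $\alpha$-bi-Hölder, and for every $W\in\mathcal W^{\alpha,b}$, for Lebesgue-almost every $\mathbf t\in\mathbb R^d$ the occupation measure $\lambda_{\mathbf t}=(W_{\mathbf t})_*\mathcal L^1$ of the function $W_{\mathbf t}(x)=W(x)+\langle\mathbf t,\Phi(x)\rangle$, where $\mathcal L^1$ is the Lebesgue measure on $\mathbb S^1$ (of total mass one), is absolutely continuous with respect to the Lebesgue measure on $\mathbb R$, with density in $L^2(\mathbb R)$. -/

import Mathlib

open MeasureTheory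

noncomputable section

/-- The Weierstrass function `W_g^{α,b}(x) = ∑_{k ≥ 0} b^{-αk} g(b^k x)` on the circle `ℝ/ℤ`.
For bounded `g` (in particular Lipschitz `g`), `α > 0` and `b ≥ 2` the series converges
absolutely. -/
def weierstrass (α : ℝ) (b : ℕ) (g : UnitAddCircle → ℝ) (x : UnitAddCircle) : ℝ :=
  ∑' k : ℕ, (b : ℝ) ^ (-(α * (k : ℝ))) * g ((b ^ k) • x)

/-- A Lipschitz function on the circle `ℝ/ℤ` (with its arc-length metric). -/
def IsLipschitzOnCircle (g : UnitAddCircle → ℝ) : Prop :=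
  ∃ K : NNReal, LipschitzWith K g

/-- The family `𝒲^{α,b}` of all Weierstrass functions of Lipschitz functions on the circle. -/
def weierstrassFamily (α : ℝ) (b : ℕ) : Set (UnitAddCircle → ℝ) :=
  {W | ∃ g : UnitAddCircle → ℝ, IsLipschitzOnCircle g ∧ W = weierstrass α b g}

/-- The Weierstrass map `Φ_G^{α,b} = (W_{g_0}, …, W_{g_{d-1}}) : ℝ/ℤ → ℝ^d`. -/
def weierstrassEmbedding (α : ℝ) (b : ℕ) {d : ℕ} (G : Fin d → UnitAddCircle → ℝ)
    (x : UnitAddCircle) : Fin d → ℝ :=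
  fun i => weierstrass α b (G i) x

/-- `Φ : ℝ/ℤ → ℝ^d` is `α`-bi-Hölder; the norm on `Fin d → ℝ` is the `ℓ^∞` norm and `dist` is the
arc-length distance on the circle. -/
def IsBiHolder (α : ℝ) {d : ℕ} (Φ : UnitAddCircle → Fin d → ℝ) : Prop :=
  ∃ c₁ c₂ : ℝ, 0 < c₁ ∧ 0 < c₂ ∧ ∀ x y : UnitAddCircle, x ≠ y →
    c₁ ≤ ‖Φ x - Φ y‖ / dist x y ^ α ∧ ‖Φ x - Φ y‖ / dist x y ^ α ≤ c₂

/-- The perturbation `W_t(x) = W(x) + ⟨t, Φ(x)⟩`. -/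
def perturbed {d : ℕ} (W : UnitAddCircle → ℝ) (Φ : UnitAddCircle → Fin d → ℝ) (t : Fin d → ℝ)
    (x : UnitAddCircle) : ℝ :=
  W x + t ⬝ᵥ Φ x

/-- The occupation measure of `f : ℝ/ℤ → ℝ`: the pushforward under `f` of the Lebesgue measure on
the circle (of total mass one). -/
def occupationMeasure (f : UnitAddCircle → ℝ) : Measure ℝ :=
  (volume : Measure UnitAddCircle).map f

/-- `μ` is absolutely continuous with respect to the Lebesgue measure on `ℝ`, and its density
belongs to `L²(ℝ)`. -/
def IsACWithL2Density (μ : Measure ℝ) : Prop :=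
  μ ≪ volume ∧ MemLp (fun y : ℝ => (μ.rnDeriv volume y).toReal) 2 volume

end

/-! Absolute continuity comes from an averaged energy estimate. A finite measure `μ` on the line has
an `L²` density once `(μ × μ){|u - v| ≤ 2r} / 2r` stays bounded along some sequence `r → 0`
(`isACWithL2Density_of_liminf`). For the occupation measure of `W_t`, integrate this quantity over
`t` in a cube. For fixed `x ≠ y` the condition confines `t` to a slab orthogonal to `Φ x - Φ y`,
which meets the cube in volume `O(r / ‖Φ x - Φ y‖) = O(r |x - y|^(-α))` by the lower Hölder bound
(`volume_cube_inter_slab_le`). Since `α < 1` this kernel is integrable, so the average is bounded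
uniformly in `r` (`lintegral_diagonalDensity_le`), and Fatou gives a finite liminf for almost every
`t`.

For existence, the upper Hölder bound holds for every Lipschitz `g` (`exists_holder_weierstrass`),
so the issue is to separate points. Distances bounded below are handled by distance functions to
grid points, which are themselves Weierstrass functions (`weierstrass_sub_smul`). Small distances
`s` are handled by sawtooths that climb by nearly `1` over a length `1 / N` and descend with slope
`-1` elsewhere. At a scale where `b^m s` is comparable to `1 / N`, some translate makes its whole
climb between the two dilated points; at every scale the loss is at most `min (b^k s) 1`, whatever
`N` is. For large `N` the total loss is at most half the gain (`weierstrass_sawtooth_sub_ge`). -/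

/-! ### A criterion for square-integrable densities. -/

/-- The squared `L²` norm of the averaged measure is controlled by the mass near the diagonal. -/
theorem lintegral_sq_measure_closedBall_le (μ : Measure ℝ) [IsFiniteMeasure μ] (r : ℝ) :
    ∫⁻ z, μ (Metric.closedBall z r) ^ 2 ≤
      (μ.prod μ) {p | |p.1 - p.2| ≤ 2 * r} * ENNReal.ofReal (2 * r) := by
  set S : Set ((ℝ × ℝ) × ℝ) := {q | |q.1.1 - q.2| ≤ r ∧ |q.1.2 - q.2| ≤ r} with hS
  have hSm : MeasurableSet S :=
    ((isClosed_le (f := fun q : (ℝ × ℝ) × ℝ => |q.1.1 - q.2|) (by fun_prop)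
      continuous_const).inter (isClosed_le (f := fun q : (ℝ × ℝ) × ℝ => |q.1.2 - q.2|)
      (by fun_prop) continuous_const)).measurableSet
  have hDm : MeasurableSet {p : ℝ × ℝ | |p.1 - p.2| ≤ 2 * r} :=
    (isClosed_le (by fun_prop) continuous_const).measurableSet
  -- Fubini on `S`: slices at fixed `z` are squares of balls, while slices at fixed `(u, v)` lie in
  -- an interval of length `2r` and are empty unless `|u - v| ≤ 2r`.
  have h1 : ((μ.prod μ).prod volume) S = ∫⁻ z, μ (Metric.closedBall z r) ^ 2 := by
    rw [Measure.prod_apply_symm hSm]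
    refine lintegral_congr fun z => ?_
    have : (fun x : ℝ × ℝ => (x, z)) ⁻¹' S =
        Metric.closedBall z r ×ˢ Metric.closedBall z r := by
      ext ⟨u, v⟩
      simp [hS, Real.dist_eq]
    rw [this, Measure.prod_prod, sq]
  rw [← h1, Measure.prod_apply hSm, mul_comm, ← lintegral_indicator_const hDm]
  refine lintegral_mono fun p => ?_
  by_cases hp : |p.1 - p.2| ≤ 2 * r
  · rw [Set.indicator_of_mem (by exact hp), ← Real.volume_closedBall p.1 r]
    refine measure_mono fun z hz => ?_
    rw [Metric.mem_closedBall, dist_comm, Real.dist_eq]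
    exact hz.1
  · rw [Set.indicator_of_notMem (by exact hp), nonpos_iff_eq_zero]
    convert measure_empty (μ := (volume : Measure ℝ))
    refine Set.eq_empty_of_forall_notMem fun z hz => hp ?_
    have h2 := hz.2
    rw [abs_sub_comm] at h2
    calc |p.1 - p.2| = |(p.1 - z) + (z - p.2)| := by ring_nf
      _ ≤ |p.1 - z| + |z - p.2| := abs_add_le _ _
      _ ≤ 2 * r := by linarith [hz.1, h2]

theorem measure_compact_mul_le (μ : Measure ℝ) [IsFiniteMeasure μ] {K U : Set ℝ} {r : ℝ}
    (hK : IsCompact K) (hKU : Metric.cthickening r K ⊆ U) :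
    ENNReal.ofReal (2 * r) * μ K ≤ ∫⁻ z in U, μ (Metric.closedBall z r) := by
  set S : Set (ℝ × ℝ) := {q | |q.1 - q.2| ≤ r} with hS
  have hSm : MeasurableSet S := (isClosed_le (by fun_prop) continuous_const).measurableSet
  have h1 : (μ.prod (volume.restrict U)) S = ∫⁻ z in U, μ (Metric.closedBall z r) := by
    rw [Measure.prod_apply_symm hSm]
    rfl
  rw [← h1, Measure.prod_apply hSm, ← lintegral_indicator_const hK.measurableSet]
  refine lintegral_mono fun u => ?_
  by_cases hu : u ∈ K
  · rw [Set.indicator_of_mem hu, ← Real.volume_closedBall u r]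
    have hsub : Metric.closedBall u r ⊆ U :=
      (Metric.closedBall_subset_cthickening hu r).trans hKU
    rw [← Measure.restrict_eq_self _ hsub]
    refine measure_mono fun z hz => ?_
    rw [Metric.mem_closedBall, dist_comm, Real.dist_eq] at hz
    exact hz
  · rw [Set.indicator_of_notMem hu]
    exact zero_le

/-- Mass of `μ ⊗ μ` in the `2r`-neighbourhood of the diagonal, normalised by `2r`. -/
noncomputable def diagonalDensity (μ : Measure ℝ) (r : ℝ) : ENNReal :=
  (μ.prod μ) {p | |p.1 - p.2| ≤ 2 * r} / ENNReal.ofReal (2 * r)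

theorem measurable_measure_closedBall (μ : Measure ℝ) [IsFiniteMeasure μ] (r : ℝ) :
    Measurable fun z => μ (Metric.closedBall z r) := by
  have hSm : MeasurableSet {q : ℝ × ℝ | |q.1 - q.2| ≤ r} :=
    (isClosed_le (by fun_prop) continuous_const).measurableSet
  exact measurable_measure_prodMk_right hSm

theorem lintegral_sq_average_le (μ : Measure ℝ) [IsFiniteMeasure μ] {r : ℝ} (hr : 0 < r) :
    ∫⁻ z, (μ (Metric.closedBall z r) / ENNReal.ofReal (2 * r)) ^ 2 ≤ diagonalDensity μ r := by
  have h0 : ENNReal.ofReal (2 * r) ≠ 0 := by simpa using hr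
  have ht : ENNReal.ofReal (2 * r) ≠ ⊤ := ENNReal.ofReal_ne_top
  simp_rw [div_eq_mul_inv, mul_pow]
  rw [lintegral_mul_const _ ((measurable_measure_closedBall μ r).pow_const 2), diagonalDensity]
  refine (mul_le_mul_left (lintegral_sq_measure_closedBall_le μ r) _).trans ?_
  rw [mul_assoc, sq, ← mul_assoc (ENNReal.ofReal (2 * r)), ENNReal.mul_inv_cancel h0 ht, one_mul,
    div_eq_mul_inv]

/-- Averaging over balls of radius `r` keeps the mass of `K` inside `U`; Cauchy–Schwarz against the
constant `1` on `U` then brings in the energy. -/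
theorem measure_compact_le (μ : Measure ℝ) [IsFiniteMeasure μ] {K U : Set ℝ} {r : ℝ} (hr : 0 < r)
    (hK : IsCompact K) (hKU : Metric.cthickening r K ⊆ U) :
    μ K ≤ diagonalDensity μ r ^ (1 / 2 : ℝ) * volume U ^ (1 / 2 : ℝ) := by
  have h0 : ENNReal.ofReal (2 * r) ≠ 0 := by simpa using hr
  have ht : ENNReal.ofReal (2 * r) ≠ ⊤ := ENNReal.ofReal_ne_top
  have hm := (measurable_measure_closedBall μ r).div_const (ENNReal.ofReal (2 * r))
  have h1 : μ K ≤ ∫⁻ z in U, μ (Metric.closedBall z r) / ENNReal.ofReal (2 * r) := by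
    simp_rw [div_eq_mul_inv]
    rw [lintegral_mul_const _ (measurable_measure_closedBall μ r), ← div_eq_mul_inv,
      ENNReal.le_div_iff_mul_le (Or.inl h0) (Or.inl ht), mul_comm]
    exact measure_compact_mul_le μ hK hKU
  refine h1.trans ?_
  have h2 := ENNReal.lintegral_mul_le_Lp_mul_Lq (volume.restrict U) Real.HolderConjugate.two_two
    hm.aemeasurable (aemeasurable_const (b := (1 : ENNReal)))
  simp only [Pi.mul_apply, mul_one, ENNReal.one_rpow, lintegral_const, one_mul,
    Measure.restrict_apply_univ] at h2
  refine h2.trans ?_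
  gcongr
  refine le_trans ?_ (lintegral_sq_average_le μ hr)
  simp only [ENNReal.rpow_two]
  exact setLIntegral_le_lintegral _ _

-- A bound along infinitely many scales suffices. With outer regularity it forces compact null sets
-- to have mass zero; the density is then the limit of ball averages (Besicovitch), and Fatou bounds
-- its `L²` norm.
open Filter Topology in
theorem isACWithL2Density_of_liminf (μ : Measure ℝ) [IsFiniteMeasure μ] {r : ℕ → ℝ}
    (hr0 : ∀ n, 0 < r n) (hr : Tendsto r atTop (𝓝 0))
    (h : liminf (fun n => diagonalDensity μ (r n)) atTop ≠ ⊤) : IsACWithL2Density μ := by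
  have hr' : Tendsto r atTop (𝓝[>] 0) :=
    tendsto_nhdsWithin_iff.2 ⟨hr, Eventually.of_forall hr0⟩
  constructor
  · obtain ⟨C, hC, hCt⟩ := exists_between h.lt_top
    have hfreq : ∃ᶠ n in atTop, diagonalDensity μ (r n) < C :=
      frequently_lt_of_liminf_lt (by isBoundedDefault) hC
    have key : ∀ K U : Set ℝ, IsCompact K → IsOpen U → K ⊆ U →
        μ K ≤ C ^ (1 / 2 : ℝ) * volume U ^ (1 / 2 : ℝ) := by
      intro K U hK hU hKU
      obtain ⟨δ, hδ, hδU⟩ := hK.exists_cthickening_subset_open hU hKU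
      obtain ⟨n, hn, hn'⟩ := (hfreq.and_eventually (hr.eventually (gt_mem_nhds hδ))).exists
      refine (measure_compact_le μ (hr0 n) hK
        ((Metric.cthickening_mono hn'.le K).trans hδU)).trans ?_
      gcongr
    refine Measure.AbsolutelyContinuous.mk fun A hA hA0 => ?_
    by_contra hne
    obtain ⟨K, hKA, hK, hKpos⟩ := hA.exists_lt_isCompact (pos_iff_ne_zero.2 hne)
    have hK0 : volume K = 0 := measure_mono_null hKA hA0
    have hlim : Tendsto (fun ε : ENNReal => C ^ (1 / 2 : ℝ) * ε ^ (1 / 2 : ℝ)) (𝓝[>] 0) (𝓝 0) := by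
      have h1 : Tendsto (fun ε : ENNReal => ε ^ (1 / 2 : ℝ)) (𝓝 0) (𝓝 0) := by
        have := (ENNReal.continuous_rpow_const (y := (1 / 2 : ℝ))).tendsto 0
        rwa [ENNReal.zero_rpow_of_pos (by norm_num)] at this
      have h2 := ENNReal.Tendsto.const_mul (a := C ^ (1 / 2 : ℝ)) h1
        (Or.inr (ENNReal.rpow_ne_top_of_nonneg (by norm_num) hCt.ne))
      rw [mul_zero] at h2
      exact h2.mono_left nhdsWithin_le_nhds
    have hle : ∀ᶠ ε : ENNReal in 𝓝[>] 0, μ K ≤ C ^ (1 / 2 : ℝ) * ε ^ (1 / 2 : ℝ) := by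
      filter_upwards [self_mem_nhdsWithin] with ε hε
      obtain ⟨U, hKU, hU, hUε⟩ := K.exists_isOpen_lt_of_lt ε (by rw [hK0]; exact hε)
      refine (key K U hK hU hKU).trans ?_
      gcongr
    exact hKpos.not_ge (ge_of_tendsto hlim hle)
  · refine ⟨(Measure.measurable_rnDeriv μ volume).ennreal_toReal.aestronglyMeasurable, ?_⟩
    rw [eLpNorm_lt_top_iff_lintegral_rpow_enorm_lt_top (by norm_num) (by norm_num)]
    refine lt_of_le_of_lt ?_ h.lt_top
    calc ∫⁻ y, ‖(μ.rnDeriv volume y).toReal‖ₑ ^ (2 : ENNReal).toReal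
        ≤ ∫⁻ y, liminf (fun n => (μ (Metric.closedBall y (r n)) /
            ENNReal.ofReal (2 * r n)) ^ 2) atTop := by
          refine lintegral_mono_ae ?_
          filter_upwards [Besicovitch.ae_tendsto_rnDeriv μ volume] with y hy
          have hy' := ((ENNReal.continuous_pow 2).tendsto _).comp (hy.comp hr')
          have : (fun n => (μ (Metric.closedBall y (r n)) / ENNReal.ofReal (2 * r n)) ^ 2)
              = ((fun x => x ^ 2) ∘ (fun r => μ (Metric.closedBall y r) /
                volume (Metric.closedBall y r)) ∘ r) := by
            ext n
            simp [Real.volume_closedBall]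
          rw [this, hy'.liminf_eq]
          simp only [ENNReal.toReal_ofNat, ENNReal.rpow_two]
          gcongr
          rw [Real.enorm_of_nonneg ENNReal.toReal_nonneg]
          exact ENNReal.ofReal_toReal_le
      _ ≤ liminf (fun n => ∫⁻ y, (μ (Metric.closedBall y (r n)) /
            ENNReal.ofReal (2 * r n)) ^ 2) atTop :=
          lintegral_liminf_le fun n =>
            ((measurable_measure_closedBall μ _).div_const _).pow_const 2
      _ ≤ _ := liminf_le_liminf (Eventually.of_forall fun n => lintegral_sq_average_le μ (hr0 n))

/-! ### Transversality in the parameter and the singular kernel. -/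

theorem volume_abs_add_mul_le (c m r : ℝ) (hm : m ≠ 0) :
    volume {z : ℝ | |c + z * m| ≤ r} ≤ ENNReal.ofReal (2 * (r / |m|)) := by
  rw [← Real.volume_closedBall (-c / m) (r / |m|)]
  refine measure_mono fun z hz => ?_
  have hz' : |c + z * m| ≤ r := hz
  rw [Metric.mem_closedBall, Real.dist_eq, le_div_iff₀ (abs_pos.2 hm), ← abs_mul]
  rwa [sub_mul, div_mul_cancel₀ _ hm, sub_neg_eq_add, add_comm]

/-- The part of a cube inside a slab of width `r` has volume of order `r`. -/
theorem volume_cube_inter_slab_le {n : ℕ} (R a r : ℝ) (v : Fin (n + 1) → ℝ) (hv : v ≠ 0) :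
    volume ({t : Fin (n + 1) → ℝ | |a + t ⬝ᵥ v| ≤ r} ∩ Set.Icc (fun _ => -R) (fun _ => R)) ≤
      ENNReal.ofReal (2 * (r / ‖v‖)) * volume (Set.Icc (fun _ : Fin n => -R) (fun _ => R)) := by
  -- Slicing along the coordinate that attains the sup norm makes every slice of length at most `2 *
  -- (r / ‖v‖)`.
  obtain ⟨i, hi⟩ : ∃ i, ‖v‖ = |v i| := by
    obtain ⟨i, -, hi⟩ := Finset.exists_mem_eq_sup' Finset.univ_nonempty (fun i => ‖v i‖₊)
    refine ⟨i, ?_⟩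
    rw [Pi.norm_def, ← Finset.sup'_eq_sup Finset.univ_nonempty, hi]
    rfl
  have hvi : v i ≠ 0 := by
    rw [← abs_pos, ← hi]
    exact norm_pos_iff.2 hv
  set B : Set (Fin n → ℝ) := Set.Icc (fun _ => -R) (fun _ => R) with hB
  set c : (Fin n → ℝ) → ℝ := fun w => a + ∑ j, w j * v (i.succAbove j) with hc
  set S : Set (ℝ × (Fin n → ℝ)) := {p | |c p.2 + p.1 * v i| ≤ r} ∩ {p | p.2 ∈ B} with hS
  have hcc : Continuous c := by fun_prop
  have hSm : MeasurableSet S := by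
    refine (IsClosed.inter ?_ ?_).measurableSet
    · exact isClosed_le (f := fun p : ℝ × (Fin n → ℝ) => |c p.2 + p.1 * v i|) (by fun_prop)
        continuous_const
    · exact isClosed_Icc.preimage continuous_snd
  have hpre : {t : Fin (n + 1) → ℝ | |a + t ⬝ᵥ v| ≤ r} ∩ Set.Icc (fun _ => -R) (fun _ => R) ⊆
      (MeasurableEquiv.piFinSuccAbove (fun _ : Fin (n + 1) => ℝ) i) ⁻¹' S := by
    rintro t ⟨ht, ht'⟩
    refine ⟨?_, ?_⟩
    · have ht1 : |a + t ⬝ᵥ v| ≤ r := ht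
      rw [dotProduct, Fin.sum_univ_succAbove _ i] at ht1
      change |a + ∑ j, t (i.succAbove j) * v (i.succAbove j) + t i * v i| ≤ r
      convert ht1 using 2
      ring
    · exact ⟨fun j => ht'.1 (i.succAbove j), fun j => ht'.2 (i.succAbove j)⟩
  refine (measure_mono hpre).trans ?_
  rw [(volume_preserving_piFinSuccAbove (fun _ : Fin (n + 1) => ℝ) i).measure_preimage
    hSm.nullMeasurableSet, Measure.volume_eq_prod, Measure.prod_apply_symm hSm,
    ← lintegral_indicator_const measurableSet_Icc]
  refine lintegral_mono fun w => ?_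
  by_cases hw : w ∈ B
  · rw [Set.indicator_of_mem hw, hi]
    exact (measure_mono fun z hz => hz.1).trans (volume_abs_add_mul_le (c w) (v i) r hvi)
  · rw [Set.indicator_of_notMem hw, nonpos_iff_eq_zero]
    convert measure_empty (μ := (volume : Measure ℝ))
    exact Set.eq_empty_of_forall_notMem fun z hz => hw hz.2

theorem lintegral_enorm_rpow_neg_lt_top {α : ℝ} (hα₁ : α < 1) :
    ∫⁻ z : UnitAddCircle, ‖z‖ₑ ^ (-α) < ⊤ := by
  have hα : (-1 : ℝ) < -α := by linarith
  have h1 : IntervalIntegrable (fun t : ℝ => t ^ (-α)) volume 0 1 :=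
    intervalIntegral.intervalIntegrable_rpow' hα
  have h2 : IntervalIntegrable (fun t : ℝ => (1 - t) ^ (-α)) volume 0 1 := by
    simpa using (h1.comp_sub_left 1).symm
  have h3 := ((intervalIntegrable_iff_integrableOn_Ioc_of_le zero_le_one).1 (h1.add h2))
  rw [← UnitAddCircle.lintegral_preimage 0]
  refine lt_of_le_of_lt ?_ h3.hasFiniteIntegral
  rw [zero_add]
  refine lintegral_mono_ae ?_
  -- The endpoint `t = 1` is dropped: for `α > 0` the `ENNReal` power is `⊤` there, while the real
  -- power `(1 - t) ^ (-α)` takes the default value `0`.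
  rw [← restrict_Ioo_eq_restrict_Ioc]
  refine (ae_restrict_iff' measurableSet_Ioo).2 (Filter.Eventually.of_forall fun t ht => ?_)
  have hA : 0 ≤ t ^ (-α) := Real.rpow_nonneg ht.1.le _
  have hB : 0 ≤ (1 - t) ^ (-α) := Real.rpow_nonneg (by linarith [ht.2]) _
  rw [Real.enorm_of_nonneg (by simpa using add_nonneg hA hB)]
  by_cases hh : t ≤ 1 / 2
  · have : ‖(t : UnitAddCircle)‖ = t := by
      rw [(AddCircle.norm_coe_eq_abs_iff _ one_ne_zero).2, abs_of_pos ht.1]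
      rw [abs_of_pos ht.1, abs_one]; exact hh
    rw [← ofReal_norm, this, ENNReal.ofReal_rpow_of_pos ht.1]
    exact ENNReal.ofReal_le_ofReal (by simpa using hB)
  · have h1t : 0 < 1 - t := by linarith [ht.2]
    have : ‖(t : UnitAddCircle)‖ = 1 - t := by
      have e : (t : UnitAddCircle) = ((t - 1 : ℝ) : UnitAddCircle) := by
        rw [AddCircle.coe_sub, AddCircle.coe_period, sub_zero]
      have e2 : |t - 1| = 1 - t := by rw [abs_sub_comm, abs_of_pos h1t]
      rw [e, (AddCircle.norm_coe_eq_abs_iff _ one_ne_zero).2, e2]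
      rw [e2, abs_one]; linarith
    rw [← ofReal_norm, this, ENNReal.ofReal_rpow_of_pos h1t]
    exact ENNReal.ofReal_le_ofReal (by simpa using hA)

theorem lintegral_enorm_sub_rpow_neg_lt_top {α : ℝ} (hα₁ : α < 1) :
    ∫⁻ p : UnitAddCircle × UnitAddCircle, ‖p.1 - p.2‖ₑ ^ (-α) < ⊤ := by
  rw [Measure.volume_eq_prod, lintegral_prod_symm _ (by fun_prop)]
  have : ∀ y : UnitAddCircle, ∫⁻ x : UnitAddCircle, ‖x - y‖ₑ ^ (-α) =
      ∫⁻ z : UnitAddCircle, ‖z‖ₑ ^ (-α) := fun y =>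
    lintegral_sub_right_eq_self (fun z : UnitAddCircle => ‖z‖ₑ ^ (-α)) y
  simp only [this, lintegral_const]
  exact ENNReal.mul_lt_top (lintegral_enorm_rpow_neg_lt_top hα₁) (measure_lt_top _ _)

/-! ### Continuity of Weierstrass functions and the average over parameters. -/

theorem lipschitz_bounded {g : UnitAddCircle → ℝ} (hg : IsLipschitzOnCircle g) :
    ∃ M, ∀ x, |g x| ≤ M := by
  obtain ⟨K, hK⟩ := hg
  obtain ⟨M, hM⟩ := isCompact_univ.exists_bound_of_continuousOn hK.continuous.continuousOn
  exact ⟨M, fun x => hM x (Set.mem_univ x)⟩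

theorem rpow_neg_mul_natCast (b : ℕ) (α : ℝ) (k : ℕ) :
    (b : ℝ) ^ (-(α * (k : ℝ))) = ((b : ℝ) ^ (-α)) ^ k := by
  rw [← Real.rpow_natCast, ← Real.rpow_mul (Nat.cast_nonneg b), neg_mul]

theorem rpow_neg_lt_one {b : ℕ} (hb : 2 ≤ b) {α : ℝ} (hα : 0 < α) : (b : ℝ) ^ (-α) < 1 :=
  Real.rpow_lt_one_of_one_lt_of_neg (by exact_mod_cast hb) (neg_lt_zero.2 hα)

theorem summable_weierstrass {b : ℕ} (hb : 2 ≤ b) {α : ℝ} (hα : 0 < α) {g : UnitAddCircle → ℝ}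
    {M : ℝ} (hM : ∀ x, |g x| ≤ M) (x : UnitAddCircle) :
    Summable fun k : ℕ => ((b : ℝ) ^ (-α)) ^ k * g ((b ^ k) • x) := by
  have hq0 : 0 ≤ (b : ℝ) ^ (-α) := Real.rpow_nonneg (Nat.cast_nonneg b) _
  refine Summable.of_norm_bounded
    ((summable_geometric_of_lt_one hq0 (rpow_neg_lt_one hb hα)).mul_right M) fun k => ?_
  rw [norm_mul, norm_pow, Real.norm_of_nonneg hq0]
  exact mul_le_mul_of_nonneg_left (hM _) (pow_nonneg hq0 k)

theorem continuous_weierstrass {b : ℕ} (hb : 2 ≤ b) {α : ℝ} (hα : 0 < α) {g : UnitAddCircle → ℝ}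
    (hg : IsLipschitzOnCircle g) : Continuous (weierstrass α b g) := by
  obtain ⟨M, hM⟩ := lipschitz_bounded hg
  obtain ⟨K, hK⟩ := hg
  have hgc := hK.continuous
  have hq0 : 0 ≤ (b : ℝ) ^ (-α) := Real.rpow_nonneg (Nat.cast_nonneg b) _
  unfold weierstrass
  simp only [rpow_neg_mul_natCast]
  refine continuous_tsum (fun k => by fun_prop)
    ((summable_geometric_of_lt_one hq0 (rpow_neg_lt_one hb hα)).mul_right M) fun k x => ?_
  rw [norm_mul, norm_pow, Real.norm_of_nonneg hq0]
  exact mul_le_mul_of_nonneg_left (hM _) (pow_nonneg hq0 k)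

theorem IsBiHolder.exists_lower {α : ℝ} {d : ℕ} {Φ : UnitAddCircle → Fin d → ℝ}
    (h : IsBiHolder α Φ) :
    ∃ c : ℝ, 0 < c ∧ ∀ x y : UnitAddCircle, x ≠ y → c * ‖x - y‖ ^ α ≤ ‖Φ x - Φ y‖ := by
  obtain ⟨c, _, hc, _, hΦ⟩ := h
  refine ⟨c, hc, fun x y hxy => ?_⟩
  rw [← dist_eq_norm x y]
  exact (le_div_iff₀ (Real.rpow_pos_of_pos (dist_pos.2 hxy) _)).1 (hΦ x y hxy).1

theorem diagonalDensity_occupationMeasure {f : UnitAddCircle → ℝ} (hf : Continuous f) (r : ℝ) :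
    diagonalDensity (occupationMeasure f) r =
      volume {p : UnitAddCircle × UnitAddCircle | |f p.1 - f p.2| ≤ 2 * r} /
        ENNReal.ofReal (2 * r) := by
  have hS : MeasurableSet {p : ℝ × ℝ | |p.1 - p.2| ≤ 2 * r} :=
    (isClosed_le (by fun_prop) continuous_const).measurableSet
  rw [diagonalDensity, occupationMeasure, Measure.map_prod_map _ _ hf.measurable hf.measurable,
    Measure.map_apply (by fun_prop) hS]
  rfl

/-- Averaged over a cube of parameters, the near-diagonal mass is bounded uniformly in the scale. -/
theorem lintegral_diagonalDensity_le {α : ℝ} (hα₀ : 0 < α) {d : ℕ} {W : UnitAddCircle → ℝ}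
    {Φ : UnitAddCircle → Fin d → ℝ} (hW : Continuous W) (hΦ : Continuous Φ) {c : ℝ} (hc : 0 < c)
    (hlow : ∀ x y : UnitAddCircle, x ≠ y → c * ‖x - y‖ ^ α ≤ ‖Φ x - Φ y‖) {R : ℝ} (hR : 0 < R)
    {r : ℝ} (hr : 0 < r) :
    ∫⁻ t in Set.Icc (fun _ : Fin d => -R) (fun _ => R),
        diagonalDensity (occupationMeasure (perturbed W Φ t)) r ≤
      ENNReal.ofReal (2 * c⁻¹) * volume (Set.Icc (fun _ : Fin (d - 1) => -R) (fun _ => R)) *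
        ∫⁻ p : UnitAddCircle × UnitAddCircle, ‖p.1 - p.2‖ₑ ^ (-α) := by
  set B : Set (Fin d → ℝ) := Set.Icc (fun _ => -R) (fun _ => R) with hB
  have h0 : ENNReal.ofReal (2 * r) ≠ 0 := by simpa using hr
  have ht : ENNReal.ofReal (2 * r) ≠ ⊤ := ENNReal.ofReal_ne_top
  have hcont : ∀ t, Continuous (perturbed W Φ t) := fun t => by
    unfold perturbed dotProduct
    fun_prop
  set S : Set ((Fin d → ℝ) × (UnitAddCircle × UnitAddCircle)) :=
    {q | |perturbed W Φ q.1 q.2.1 - perturbed W Φ q.1 q.2.2| ≤ 2 * r} with hS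
  have hSm : MeasurableSet S := by
    refine (isClosed_le (f := fun q : (Fin d → ℝ) × (UnitAddCircle × UnitAddCircle) =>
      |perturbed W Φ q.1 q.2.1 - perturbed W Φ q.1 q.2.2|) ?_ continuous_const).measurableSet
    unfold perturbed dotProduct
    fun_prop
  simp only [diagonalDensity_occupationMeasure (hcont _), div_eq_mul_inv]
  have hmeas : Measurable fun t : Fin d → ℝ => volume {p : UnitAddCircle × UnitAddCircle |
      |perturbed W Φ t p.1 - perturbed W Φ t p.2| ≤ 2 * r} :=
    measurable_measure_prodMk_left hSm
  rw [lintegral_mul_const _ hmeas, ← div_eq_mul_inv,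
    ENNReal.div_le_iff_le_mul (Or.inl h0) (Or.inl ht)]
  have h1 : ((volume.restrict B).prod volume) S = ∫⁻ t in B, volume
      {p : UnitAddCircle × UnitAddCircle |
        |perturbed W Φ t p.1 - perturbed W Φ t p.2| ≤ 2 * r} := by
    rw [Measure.prod_apply hSm]
    rfl
  rw [← h1, Measure.prod_apply_symm hSm, mul_right_comm, ← lintegral_const_mul _ (by fun_prop)]
  refine lintegral_mono fun p => ?_
  change (volume.restrict B) {t | |perturbed W Φ t p.1 - perturbed W Φ t p.2| ≤ 2 * r} ≤ _
  by_cases hp : p.1 = p.2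
  -- On the diagonal the kernel is `⊤`, so the bound is trivial once the constants in front of it
  -- are known to be nonzero.
  · have hQ : volume (Set.Icc (fun _ : Fin (d - 1) => -R) (fun _ => R)) ≠ 0 := by
      rw [Real.volume_Icc_pi, Finset.prod_ne_zero_iff]
      intro i _
      rw [ne_eq, ENNReal.ofReal_eq_zero]
      linarith
    have hC : ENNReal.ofReal (2 * c⁻¹) ≠ 0 := by simpa using hc
    rw [hp, sub_self, enorm_zero, ENNReal.zero_rpow_of_neg (neg_lt_zero.2 hα₀),
      ENNReal.mul_top (mul_ne_zero (mul_ne_zero hC hQ) h0)]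
    exact le_top
  · have hpos : 0 < ‖p.1 - p.2‖ := norm_pos_iff.2 (sub_ne_zero.2 hp)
    have hpos' : 0 < ‖p.1 - p.2‖ ^ α := Real.rpow_pos_of_pos hpos α
    have hv := hlow p.1 p.2 hp
    have hv0 : Φ p.1 - Φ p.2 ≠ 0 := norm_pos_iff.1 ((mul_pos hc hpos').trans_le hv)
    have hset : {t | |perturbed W Φ t p.1 - perturbed W Φ t p.2| ≤ 2 * r} =
        {t | |(W p.1 - W p.2) + t ⬝ᵥ (Φ p.1 - Φ p.2)| ≤ 2 * r} := by
      ext t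
      simp only [perturbed, dotProduct_sub, Set.mem_ofPred_eq]
      rw [show W p.1 + t ⬝ᵥ Φ p.1 - (W p.2 + t ⬝ᵥ Φ p.2) =
        W p.1 - W p.2 + (t ⬝ᵥ Φ p.1 - t ⬝ᵥ Φ p.2) by ring]
    rw [hset, Measure.restrict_apply' measurableSet_Icc]
    -- For `d = 0` two values of `Φ` cannot differ, so the truncated `d - 1` is only used as a true
    -- predecessor.
    obtain _ | n := d
    · exact absurd (Subsingleton.elim _ _) hv0
    refine (volume_cube_inter_slab_le R _ _ _ hv0).trans ?_
    rw [mul_right_comm _ (volume _), mul_right_comm _ (volume _)]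
    refine mul_le_mul_left ?_ _
    rw [← ofReal_norm, ENNReal.ofReal_rpow_of_pos hpos, ← ENNReal.ofReal_mul (by positivity),
      ← ENNReal.ofReal_mul (by positivity)]
    refine ENNReal.ofReal_le_ofReal ?_
    rw [Real.rpow_neg hpos.le]
    calc 2 * (2 * r / ‖Φ p.1 - Φ p.2‖) ≤ 2 * (2 * r / (c * ‖p.1 - p.2‖ ^ α)) := by gcongr
      _ = 2 * c⁻¹ * (2 * r) * (‖p.1 - p.2‖ ^ α)⁻¹ := by field_simp

open Filter Topology in
theorem ae_isACWithL2Density {α : ℝ} (hα₀ : 0 < α) (hα₁ : α < 1) {d : ℕ} {W : UnitAddCircle → ℝ}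
    {Φ : UnitAddCircle → Fin d → ℝ} (hW : Continuous W) (hΦ : Continuous Φ)
    (hbi : IsBiHolder α Φ) :
    ∀ᵐ t : Fin d → ℝ, IsACWithL2Density (occupationMeasure (perturbed W Φ t)) := by
  obtain ⟨c, hc, hlow⟩ := hbi.exists_lower
  have hcont : ∀ t, Continuous (perturbed W Φ t) := fun t => by
    unfold perturbed dotProduct
    fun_prop
  set r : ℕ → ℝ := fun n => 1 / ((n : ℝ) + 1) with hr
  have hr0 : ∀ n, 0 < r n := fun n => by positivity
  have hmeas : ∀ n, Measurable fun t : Fin d → ℝ =>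
      diagonalDensity (occupationMeasure (perturbed W Φ t)) (r n) := by
    intro n
    simp only [diagonalDensity_occupationMeasure (hcont _)]
    have hSm : MeasurableSet {q : (Fin d → ℝ) × (UnitAddCircle × UnitAddCircle) |
        |perturbed W Φ q.1 q.2.1 - perturbed W Φ q.1 q.2.2| ≤ 2 * r n} := by
      refine (isClosed_le (f := fun q : (Fin d → ℝ) × (UnitAddCircle × UnitAddCircle) =>
        |perturbed W Φ q.1 q.2.1 - perturbed W Φ q.1 q.2.2|) ?_ continuous_const).measurableSet
      unfold perturbed dotProduct
      fun_prop
    exact (measurable_measure_prodMk_left (ν := volume) hSm).div_const _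
  have hcube : ∀ m : ℕ, ∀ᵐ t : Fin d → ℝ,
      t ∈ Set.Icc (fun _ : Fin d => -((m : ℝ) + 1)) (fun _ => (m : ℝ) + 1) →
        liminf (fun n => diagonalDensity (occupationMeasure (perturbed W Φ t)) (r n)) atTop
          < ⊤ := by
    intro m
    rw [← ae_restrict_iff' measurableSet_Icc]
    refine ae_lt_top (Measurable.liminf hmeas) (ne_top_of_le_ne_top ?_ (lintegral_liminf_le hmeas))
    refine ne_top_of_le_ne_top ?_ (liminf_le_liminf (Eventually.of_forall fun n =>
      lintegral_diagonalDensity_le hα₀ hW hΦ hc hlow (by positivity : (0 : ℝ) < m + 1) (hr0 n)))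
    rw [liminf_const]
    exact (ENNReal.mul_lt_top (ENNReal.mul_lt_top ENNReal.ofReal_lt_top
      isCompact_Icc.measure_lt_top) (lintegral_enorm_sub_rpow_neg_lt_top hα₁)).ne
  filter_upwards [ae_all_iff.2 hcube] with t ht
  obtain ⟨m, hm⟩ := exists_nat_ge ‖t‖
  have htm : t ∈ Set.Icc (fun _ : Fin d => -((m : ℝ) + 1)) (fun _ => (m : ℝ) + 1) := by
    have : ∀ i, |t i| ≤ (m : ℝ) + 1 := fun i =>
      (norm_le_pi_norm t i).trans (hm.trans (by linarith))
    exact ⟨fun i => (abs_le.1 (this i)).1, fun i => (abs_le.1 (this i)).2⟩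
  have : IsFiniteMeasure (occupationMeasure (perturbed W Φ t)) := by
    unfold occupationMeasure
    infer_instance
  exact isACWithL2Density_of_liminf _ hr0 tendsto_one_div_add_atTop_nhds_zero_nat (ht m htm).ne

/-! ### Sawtooth functions. -/

/-- The monotone continuous staircase that climbs from `m` to `m + 1` on `[m, m + 1 / N]` and is
constant on `[m + 1 / N, m + 1]`. -/
noncomputable def staircase (N : ℕ) (t : ℝ) : ℝ := ⌊t⌋ + min 1 (N * Int.fract t)

theorem staircase_add_one (N : ℕ) (t : ℝ) : staircase N (t + 1) = staircase N t + 1 := by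
  simp only [staircase, Int.floor_add_one, Int.fract_add_one, Int.cast_add, Int.cast_one]
  ring

theorem staircase_mono (N : ℕ) : Monotone (staircase N) := by
  intro s t hst
  have hs := Int.fract_nonneg s
  have ht := Int.fract_nonneg t
  rcases (Int.floor_mono hst).eq_or_lt with h | h
  · have : Int.fract s ≤ Int.fract t := by
      unfold Int.fract
      rw [h]
      linarith
    unfold staircase
    rw [h]
    gcongr
  · have h' : (⌊s⌋ : ℝ) + 1 ≤ ⌊t⌋ := by exact_mod_cast h
    have h1 : min 1 ((N : ℝ) * Int.fract s) ≤ 1 := min_le_left _ _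
    have h2 : 0 ≤ min 1 ((N : ℝ) * Int.fract t) := le_min zero_le_one (by positivity)
    unfold staircase
    linarith

theorem staircase_sub_le {N : ℕ} (hN : 1 ≤ N) {s t : ℝ} (hst : s ≤ t) :
    staircase N t - staircase N s ≤ N * (t - s) := by
  have hN' : (1 : ℝ) ≤ N := by exact_mod_cast hN
  have hs := Int.floor_add_fract s
  have ht := Int.floor_add_fract t
  have hs1 := Int.fract_lt_one s
  have hs0 := Int.fract_nonneg s
  have ht0 := Int.fract_nonneg t
  have h2 : min 1 ((N : ℝ) * Int.fract t) ≤ N * Int.fract t := min_le_right _ _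
  unfold staircase
  rcases (Int.floor_mono hst).eq_or_lt with h | h
  · have hle : Int.fract s ≤ Int.fract t := by
      unfold Int.fract
      rw [h]
      linarith
    have e : t - s = Int.fract t - Int.fract s := by
      unfold Int.fract
      rw [h]
      ring
    rw [h, e]
    have h3 : (N : ℝ) * Int.fract s ≤ N * Int.fract t := by gcongr
    rcases min_cases 1 ((N : ℝ) * Int.fract s) with ⟨h4, h5⟩ | ⟨h4, h5⟩
    · rw [h4]
      have : min 1 ((N : ℝ) * Int.fract t) ≤ 1 := min_le_left _ _
      nlinarith
    · rw [h4]
      nlinarith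
  · have h' : (⌊s⌋ : ℝ) + 1 ≤ ⌊t⌋ := by exact_mod_cast h
    have e : t - s = (⌊t⌋ - ⌊s⌋ - 1) + Int.fract t + (1 - Int.fract s) := by linarith
    have h6 : (⌊t⌋ - ⌊s⌋ - 1 : ℝ) ≤ N * (⌊t⌋ - ⌊s⌋ - 1) := by nlinarith
    have h7 : 1 - min 1 ((N : ℝ) * Int.fract s) ≤ N * (1 - Int.fract s) := by
      rcases min_cases 1 ((N : ℝ) * Int.fract s) with ⟨h4, h5⟩ | ⟨h4, h5⟩ <;> rw [h4] <;> nlinarith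
    rw [e, mul_add, mul_add]
    linarith

theorem staircase_sub_self_mem {N : ℕ} (hN : 1 ≤ N) (t : ℝ) :
    0 ≤ staircase N t - t ∧ staircase N t - t ≤ 1 := by
  have hN' : (1 : ℝ) ≤ N := by exact_mod_cast hN
  have ht := Int.floor_add_fract t
  have ht1 := Int.fract_lt_one t
  have ht0 := Int.fract_nonneg t
  have e : staircase N t - t = min 1 (N * Int.fract t) - Int.fract t := by
    unfold staircase
    linarith
  rw [e]
  refine ⟨sub_nonneg.2 (le_min ht1.le (by nlinarith)), ?_⟩
  linarith [min_le_left 1 ((N : ℝ) * Int.fract t)]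

theorem staircase_intCast (N : ℕ) (m : ℤ) : staircase N m = m := by
  simp [staircase]

theorem staircase_intCast_add_inv {N : ℕ} (hN : 2 ≤ N) (m : ℤ) :
    staircase N (m + 1 / N) = m + 1 := by
  have hN' : (2 : ℝ) ≤ N := by exact_mod_cast hN
  have h0 : (0 : ℝ) < N := by linarith
  have hf : Int.fract (1 / (N : ℝ)) = 1 / N :=
    Int.fract_eq_self.2 ⟨by positivity, by rw [div_lt_one h0]; linarith⟩
  have hfl : ⌊1 / (N : ℝ)⌋ = 0 := by
    rw [Int.floor_eq_zero_iff]
    exact ⟨by positivity, by rw [div_lt_one h0]; linarith⟩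
  unfold staircase
  rw [Int.fract_intCast_add, Int.floor_intCast_add, hf, hfl, mul_one_div_cancel h0.ne']
  simp

/-- The sawtooth: it climbs steeply on `[0, 1 / N]` and descends with slope `-1` otherwise. -/
noncomputable def realSawtooth (N : ℕ) (t : ℝ) : ℝ := staircase N t - t

theorem realSawtooth_periodic (N : ℕ) : Function.Periodic (realSawtooth N) 1 := fun t => by
  rw [realSawtooth, realSawtooth, staircase_add_one]
  ring

/-- The one-sided bound does not involve `N`: monotonicity of the staircase gives `-s`, and the
range `[0, 1]` of the sawtooth gives `-1`. This is what lets `N` be taken large later. -/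
theorem realSawtooth_sub_ge {N : ℕ} (hN : 1 ≤ N) (t : ℝ) {s : ℝ} (hs : 0 ≤ s) :
    -min s 1 ≤ realSawtooth N (t + s) - realSawtooth N t := by
  have h1 := staircase_mono N (show t ≤ t + s by linarith)
  have h2 := (staircase_sub_self_mem hN (t + s)).1
  have h3 := (staircase_sub_self_mem hN t).2
  unfold realSawtooth
  rcases min_cases s 1 with ⟨h, -⟩ | ⟨h, -⟩ <;> rw [h] <;> linarith

theorem realSawtooth_sub_ge_of_mem {N : ℕ} (hN : 2 ≤ N) {t s : ℝ} {m : ℤ} (h1 : t ≤ m)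
    (h2 : m + 1 / N ≤ t + s) : 1 - s ≤ realSawtooth N (t + s) - realSawtooth N t := by
  have h3 := staircase_mono N h1
  have h4 := staircase_mono N h2
  rw [staircase_intCast] at h3
  rw [staircase_intCast_add_inv hN] at h4
  unfold realSawtooth
  linarith

theorem abs_realSawtooth_sub_le {N : ℕ} (hN : 1 ≤ N) (t : ℝ) {s : ℝ} (hs : 0 ≤ s) :
    |realSawtooth N (t + s) - realSawtooth N t| ≤ N * s := by
  have hN' : (1 : ℝ) ≤ N := by exact_mod_cast hN
  have h1 := staircase_mono N (show t ≤ t + s by linarith)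
  have h2 := staircase_sub_le hN (show t ≤ t + s by linarith)
  rw [add_sub_cancel_left] at h2
  unfold realSawtooth
  rw [abs_le]
  constructor <;> nlinarith

/-- The translate of the sawtooth that climbs on `[i / N, (i + 1) / N]`, on the circle. -/
noncomputable def sawtooth (N : ℕ) (i : ℤ) (x : UnitAddCircle) : ℝ :=
  (realSawtooth_periodic N).lift (x - ((i / N : ℝ) : UnitAddCircle))

theorem sawtooth_coe (N : ℕ) (i : ℤ) (t : ℝ) :
    sawtooth N i (t : UnitAddCircle) = realSawtooth N (t - i / N) := rfl

/-- By periodicity only `N` translates are distinct, so finitely many coordinates suffice. -/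
theorem sawtooth_emod {N : ℕ} (hN : N ≠ 0) (i : ℤ) : sawtooth N (i % N) = sawtooth N i := by
  have hN' : (N : ℝ) ≠ 0 := by exact_mod_cast hN
  ext x
  induction x using QuotientAddGroup.induction_on with
  | H t =>
    rw [sawtooth_coe, sawtooth_coe]
    have e : (i : ℝ) / N = ((i % N : ℤ) : ℝ) / N + ((i / N : ℤ) : ℝ) := by
      have : ((i % N + N * (i / N) : ℤ) : ℝ) = i := by rw [Int.emod_add_mul_ediv]
      push_cast at this
      rw [← this]
      field_simp
    rw [e, ← sub_sub, ← mul_one ((i / N : ℤ) : ℝ), (realSawtooth_periodic N).sub_int_mul_eq]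

/-- Two points of the circle lift to the endpoints of an interval of length their distance. -/
theorem exists_lift_interval (x y : UnitAddCircle) :
    ∃ t s : ℝ, s = dist x y ∧
      ((x = (t : UnitAddCircle) ∧ y = ((t + s : ℝ) : UnitAddCircle)) ∨
        (y = (t : UnitAddCircle) ∧ x = ((t + s : ℝ) : UnitAddCircle))) := by
  obtain ⟨a, rfl⟩ := QuotientAddGroup.mk_surjective x
  obtain ⟨c, rfl⟩ := QuotientAddGroup.mk_surjective y
  change ∃ t s : ℝ, s = dist (a : UnitAddCircle) (c : UnitAddCircle) ∧
    (((a : UnitAddCircle) = (t : UnitAddCircle) ∧ (c : UnitAddCircle) = ((t + s : ℝ) : UnitAddCircle)) ∨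
      ((c : UnitAddCircle) = (t : UnitAddCircle) ∧ (a : UnitAddCircle) = ((t + s : ℝ) : UnitAddCircle)))
  set n : ℤ := round (a - c) with hn
  have hz : ((n : ℝ) : UnitAddCircle) = 0 := by
    rw [AddCircle.coe_eq_zero_iff]
    exact ⟨n, by simp⟩
  have hd : dist (a : UnitAddCircle) (c : UnitAddCircle) = |a - c - n| := by
    rw [dist_eq_norm, ← AddCircle.coe_sub, UnitAddCircle.norm_eq]
  rcases le_total 0 (a - c - n) with h | h
  · refine ⟨c, a - c - n, by rw [hd, abs_of_nonneg h], Or.inr ⟨rfl, ?_⟩⟩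
    rw [show c + (a - c - n) = a - n by ring, AddCircle.coe_sub, hz, sub_zero]
  · refine ⟨a, -(a - c - n), by rw [hd, abs_of_nonpos h], Or.inl ⟨rfl, ?_⟩⟩
    rw [show a + -(a - c - n) = c + n by ring, AddCircle.coe_add, hz, add_zero]

theorem isLipschitzOnCircle_sawtooth {N : ℕ} (hN : 1 ≤ N) (i : ℤ) :
    IsLipschitzOnCircle (sawtooth N i) := by
  have key : ∀ t s : ℝ, 0 ≤ s →
      dist (sawtooth N i ((t + s : ℝ) : UnitAddCircle)) (sawtooth N i (t : UnitAddCircle)) ≤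
        N * s := by
    intro t s hs
    rw [sawtooth_coe, sawtooth_coe, Real.dist_eq, add_sub_right_comm]
    exact abs_realSawtooth_sub_le hN _ hs
  refine ⟨N, LipschitzWith.of_dist_le_mul fun x y => ?_⟩
  obtain ⟨t, s, hs, ⟨rfl, rfl⟩ | ⟨rfl, rfl⟩⟩ := exists_lift_interval x y
  · rw [← hs, dist_comm]
    exact key t s (hs ▸ dist_nonneg)
  · rw [← hs]
    exact key t s (hs ▸ dist_nonneg)

/-! ### Multiscale sums and the upper Hölder bound. -/

/-- The multiscale error `∑ q ^ k min (B ^ k s, 1)`, split at the `n`-th term. -/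
theorem tsum_pow_mul_min_le {q B : ℝ} (hq0 : 0 < q) (hq1 : q < 1) (hB : 0 < B) (hp : 1 < q * B)
    {s : ℝ} (hs : 0 ≤ s) (n : ℕ) :
    Summable (fun k : ℕ => q ^ k * min (B ^ k * s) 1) ∧
      ∑' k : ℕ, q ^ k * min (B ^ k * s) 1 ≤
        s * (q * B) ^ n / (q * B - 1) + q ^ n / (1 - q) := by
  have hle : ∀ k : ℕ, q ^ k * min (B ^ k * s) 1 ≤ q ^ k := fun k =>
    mul_le_of_le_one_right (by positivity) (min_le_right _ _)
  have h0 : ∀ k : ℕ, 0 ≤ q ^ k * min (B ^ k * s) 1 := fun k =>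
    mul_nonneg (by positivity) (le_min (by positivity) zero_le_one)
  have hgeo := summable_geometric_of_lt_one hq0.le hq1
  have hsum : Summable (fun k : ℕ => q ^ k * min (B ^ k * s) 1) :=
    Summable.of_nonneg_of_le h0 hle hgeo
  refine ⟨hsum, ?_⟩
  rw [← hsum.sum_add_tsum_nat_add n]
  refine add_le_add ?_ ?_
  · calc ∑ k ∈ Finset.range n, q ^ k * min (B ^ k * s) 1
        ≤ ∑ k ∈ Finset.range n, (q * B) ^ k * s := by
          refine Finset.sum_le_sum fun k _ => ?_
          rw [mul_pow, mul_assoc]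
          gcongr
          exact min_le_left _ _
      _ = s * ((q * B) ^ n - 1) / (q * B - 1) := by
          rw [← Finset.sum_mul, geom_sum_eq hp.ne']
          ring
      _ ≤ s * (q * B) ^ n / (q * B - 1) := by
          have : 0 < q * B - 1 := by linarith
          gcongr
          linarith
  · calc ∑' k : ℕ, q ^ (k + n) * min (B ^ (k + n) * s) 1 ≤ ∑' k : ℕ, q ^ k * q ^ n :=
          Summable.tsum_le_tsum (fun k => by rw [← pow_add]; exact hle (k + n))
            ((summable_nat_add_iff n).2 hsum) (hgeo.mul_right _)
      _ = q ^ n / (1 - q) := by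
          rw [tsum_mul_right, tsum_geometric_of_lt_one hq0.le hq1]
          ring

/-- Dilating by powers of `B` overshoots a threshold by at most one factor `B`. -/
theorem exists_scale {B : ℝ} (hB : 1 < B) {s θ : ℝ} (hs : 0 < s) (hsθ : s ≤ θ) :
    ∃ m : ℕ, θ ≤ B ^ m * s ∧ B ^ m * s ≤ B * θ := by
  obtain ⟨n, hn, hn'⟩ := exists_nat_pow_near ((one_le_div hs).2 hsθ) hB
  refine ⟨n + 1, ((div_lt_iff₀ hs).1 hn').le, ?_⟩
  rw [le_div_iff₀ hs] at hn
  rw [pow_succ', mul_assoc]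
  gcongr

theorem rpow_eq_pow_mul_rpow {B : ℝ} (hB : 0 < B) (α : ℝ) {s : ℝ} (hs : 0 < s) (m : ℕ) :
    s ^ α = (B ^ (-α)) ^ m * (B ^ m * s) ^ α := by
  rw [Real.mul_rpow (by positivity) hs.le, ← mul_assoc, ← Real.rpow_natCast, ← Real.rpow_natCast,
    ← Real.rpow_mul hB.le, ← Real.rpow_mul hB.le, ← Real.rpow_add hB]
  ring_nf
  simp

theorem one_lt_rpow_neg_mul {b : ℕ} (hb : 2 ≤ b) {α : ℝ} (hα₁ : α < 1) :
    1 < (b : ℝ) ^ (-α) * b := by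
  have hb0 : (0 : ℝ) < b := by positivity
  rw [← Real.rpow_add_one hb0.ne']
  exact Real.one_lt_rpow (by exact_mod_cast hb) (by linarith)

theorem weierstrass_eq (α : ℝ) (b : ℕ) (g : UnitAddCircle → ℝ) (x : UnitAddCircle) :
    weierstrass α b g x = ∑' k : ℕ, ((b : ℝ) ^ (-α)) ^ k * g ((b ^ k) • x) := by
  simp only [weierstrass, rpow_neg_mul_natCast]

theorem dist_nsmul_le (n : ℕ) (x y : UnitAddCircle) : dist (n • x) (n • y) ≤ n * dist x y := by
  rw [dist_eq_norm, ← nsmul_sub, dist_eq_norm]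
  exact norm_nsmul_le

theorem circle_dist_le_one (x y : UnitAddCircle) : dist x y ≤ 1 := by
  rw [dist_eq_norm]
  have := AddCircle.norm_le_half_period (1 : ℝ) (x := x - y) one_ne_zero
  rw [abs_one] at this
  linarith

/-- Weierstrass functions of Lipschitz functions are `α`-Hölder. -/
theorem exists_holder_weierstrass {b : ℕ} (hb : 2 ≤ b) {α : ℝ} (hα₀ : 0 < α) (hα₁ : α < 1)
    {g : UnitAddCircle → ℝ} (hg : IsLipschitzOnCircle g) :
    ∃ C : ℝ, 0 ≤ C ∧ ∀ x y : UnitAddCircle, x ≠ y →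
      |weierstrass α b g x - weierstrass α b g y| ≤ C * dist x y ^ α := by
  obtain ⟨M, hM⟩ := lipschitz_bounded hg
  obtain ⟨K, hK⟩ := hg
  have hb0 : (0 : ℝ) < b := by positivity
  have hb1 : (1 : ℝ) < b := by exact_mod_cast hb
  set q : ℝ := (b : ℝ) ^ (-α) with hq
  have hq0 : 0 < q := Real.rpow_pos_of_pos hb0 _
  have hq1 : q < 1 := rpow_neg_lt_one hb hα₀
  have hp : 1 < q * b := one_lt_rpow_neg_mul hb hα₁
  have hM0 : 0 ≤ M := (abs_nonneg _).trans (hM 0)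
  -- With this constant, increments of `g` are at most `A * min dist 1`, so the multiscale sum
  -- controls the whole series.
  set A : ℝ := max K (2 * M) with hA
  have hA0 : 0 ≤ A := le_max_of_le_left K.2
  have hp' : 0 < q * b - 1 := by linarith
  have hq1' : 0 < 1 - q := by linarith
  refine ⟨A * (b / (q * b - 1) + 1 / (1 - q)), by positivity, fun x y hxy => ?_⟩
  set s := dist x y with hs
  have hs0 : 0 < s := dist_pos.2 hxy
  obtain ⟨m, hm1, hm2⟩ := exists_scale hb1 hs0 (circle_dist_le_one x y)
  obtain ⟨hsum, hE⟩ := tsum_pow_mul_min_le hq0 hq1 hb0 hp hs0.le m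
  have hterm : ∀ k : ℕ, ‖q ^ k * g ((b ^ k) • x) - q ^ k * g ((b ^ k) • y)‖ ≤
      A * (q ^ k * min ((b : ℝ) ^ k * s) 1) := by
    intro k
    rw [← mul_sub, norm_mul, Real.norm_of_nonneg (by positivity), mul_left_comm]
    gcongr
    rw [mul_min_of_nonneg _ _ hA0, mul_one]
    refine le_min ?_ ?_
    · rw [← dist_eq_norm]
      refine (hK.dist_le_mul _ _).trans ?_
      have := dist_nsmul_le (b ^ k) x y
      push_cast at this
      exact mul_le_mul (le_max_left _ _) this dist_nonneg hA0
    · refine le_trans ?_ (le_max_right _ _)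
      refine (abs_sub _ _).trans ?_
      linarith [hM ((b ^ k) • x), hM ((b ^ k) • y)]
  rw [weierstrass_eq, weierstrass_eq, ← (summable_weierstrass hb hα₀ hM x).tsum_sub
    (summable_weierstrass hb hα₀ hM y), ← Real.norm_eq_abs]
  refine (tsum_of_norm_bounded (hsum.mul_left A).hasSum hterm).trans ?_
  rw [tsum_mul_left, mul_assoc]
  gcongr
  refine hE.trans ?_
  rw [rpow_eq_pow_mul_rpow hb0 α hs0 m, ← hq]
  have h1 : 1 ≤ ((b : ℝ) ^ m * s) ^ α := Real.one_le_rpow hm1 hα₀.le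
  calc s * (q * b) ^ m / (q * b - 1) + q ^ m / (1 - q)
      = q ^ m * (b ^ m * s / (q * b - 1) + 1 / (1 - q)) := by rw [mul_pow]; ring
    _ ≤ q ^ m * (b * 1 / (q * b - 1) + 1 / (1 - q)) := by gcongr
    _ ≤ (b / (q * b - 1) + 1 / (1 - q)) * (q ^ m * ((b : ℝ) ^ m * s) ^ α) := by
      rw [mul_one, mul_comm]
      gcongr
      exact le_mul_of_one_le_right (by positivity) h1

/-! ### Separation of points and the bi-Hölder embedding. -/

/-- Every Lipschitz function is a Weierstrass function. -/
theorem weierstrass_sub_smul {b : ℕ} (hb : 2 ≤ b) {α : ℝ} (hα₀ : 0 < α) {h : UnitAddCircle → ℝ}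
    {M : ℝ} (hM : ∀ x, |h x| ≤ M) :
    weierstrass α b (fun x => h x - (b : ℝ) ^ (-α) * h (b • x)) = h := by
  ext x
  set q : ℝ := (b : ℝ) ^ (-α) with hq
  have hsum := summable_weierstrass hb hα₀ hM x
  have hsum' := (summable_nat_add_iff 1).2 hsum
  rw [weierstrass_eq, ← hq]
  -- The series telescopes, leaving its zeroth term `h x`.
  have e : ∀ k : ℕ, q ^ k * (h ((b ^ k) • x) - q * h (b • (b ^ k) • x)) =
      q ^ k * h ((b ^ k) • x) - q ^ (k + 1) * h ((b ^ (k + 1)) • x) := by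
    intro k
    rw [smul_smul, ← pow_succ', pow_succ q]
    ring
  simp only [e]
  rw [hsum.tsum_sub hsum', hsum.tsum_eq_zero_add]
  simp

theorem isLipschitzOnCircle_sub_smul {h : UnitAddCircle → ℝ} (hh : IsLipschitzOnCircle h) (q : ℝ)
    (b : ℕ) : IsLipschitzOnCircle (fun x => h x - q * h (b • x)) := by
  obtain ⟨K, hK⟩ := hh
  have h1 : LipschitzWith b (fun x : UnitAddCircle => b • x) :=
    LipschitzWith.of_dist_le_mul fun x y => by simpa using dist_nsmul_le b x y
  have h2 : LipschitzWith ‖q‖₊ (fun y : ℝ => q * y) :=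
    LipschitzWith.of_dist_le_mul fun x y => by
      rw [Real.dist_eq, ← mul_sub, abs_mul, Real.dist_eq]
      rfl
  exact ⟨_, hK.sub (h2.comp (hK.comp h1))⟩

theorem exists_int_grid_interval {N : ℕ} (hN : 0 < N) {t s : ℝ} (hs : 2 / N ≤ s) :
    ∃ i : ℤ, t ≤ i / N ∧ (i + 1) / N ≤ t + s := by
  have hN' : (0 : ℝ) < N := by exact_mod_cast hN
  refine ⟨⌈t * N⌉, ?_, ?_⟩
  · rw [le_div_iff₀ hN']
    exact Int.le_ceil _
  · rw [div_le_iff₀ hN', add_mul]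
    rw [div_le_iff₀ hN'] at hs
    linarith [Int.ceil_lt_add_one (t * N)]

/-- At distances below `2 / N`, one of the sawtooth functions separates the points. -/
theorem weierstrass_sawtooth_sub_ge {b : ℕ} (hb : 2 ≤ b) {α : ℝ} (hα₀ : 0 < α) (hα₁ : α < 1)
    {N J : ℕ} (hN : 2 * b ≤ N) (hJ : ((b : ℝ) ^ (-α)) ^ J / (1 - (b : ℝ) ^ (-α)) ≤ 1 / 4)
    (hNJ : 2 * b * ((b : ℝ) ^ (-α) * b) ^ J / ((b : ℝ) ^ (-α) * b - 1) / N ≤ 1 / 4)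
    (t : ℝ) {s : ℝ} (hs0 : 0 < s) (hs : s ≤ 2 / N) :
    ∃ i : ℤ, s ^ α / 2 ≤ weierstrass α b (sawtooth N i) ((t + s : ℝ) : UnitAddCircle) -
      weierstrass α b (sawtooth N i) (t : UnitAddCircle) := by
  have hb0 : (0 : ℝ) < b := by positivity
  have hb1 : (1 : ℝ) < b := by exact_mod_cast hb
  have hN2 : 2 ≤ N := by lia
  have hN1 : 1 ≤ N := by lia
  have hN0 : (0 : ℝ) < N := by exact_mod_cast hN1
  set q : ℝ := (b : ℝ) ^ (-α) with hq
  have hq0 : 0 < q := Real.rpow_pos_of_pos hb0 _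
  have hq1 : q < 1 := rpow_neg_lt_one hb hα₀
  have hp : 1 < q * b := one_lt_rpow_neg_mul hb hα₁
  have hp' : 0 < q * b - 1 := by linarith
  -- Here `2 / N ≤ b^m s ≤ 2b / N ≤ 1`: long enough to contain a full grid cell, short enough for
  -- the error below scale `m + J` to carry a factor `1 / N`.
  obtain ⟨m, hm1, hm2⟩ := exists_scale hb1 hs0 hs
  have hy1 : (b : ℝ) ^ m * s ≤ 1 := by
    refine hm2.trans ?_
    rw [← mul_div_assoc, div_le_one hN0, mul_comm]
    exact_mod_cast hN
  obtain ⟨i, hi1, hi2⟩ := exists_int_grid_interval hN1 (t := (b : ℝ) ^ m * t) hm1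
  refine ⟨i, ?_⟩
  obtain ⟨M, hM⟩ := lipschitz_bounded (isLipschitzOnCircle_sawtooth hN1 i)
  obtain ⟨hsum, hE⟩ := tsum_pow_mul_min_le hq0 hq1 hb0 hp hs0.le (m + J)
  have hS := (summable_weierstrass hb hα₀ hM ((t + s : ℝ) : UnitAddCircle)).sub
    (summable_weierstrass hb hα₀ hM (t : UnitAddCircle))
  rw [weierstrass_eq, weierstrass_eq, ← (summable_weierstrass hb hα₀ hM _).tsum_sub
    (summable_weierstrass hb hα₀ hM _)]
  have hterm : ∀ k : ℕ, q ^ k * sawtooth N i ((b ^ k) • ((t + s : ℝ) : UnitAddCircle)) -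
      q ^ k * sawtooth N i ((b ^ k) • (t : UnitAddCircle)) =
      q ^ k * (realSawtooth N ((b ^ k * t - i / N) + b ^ k * s) -
        realSawtooth N (b ^ k * t - i / N)) := by
    intro k
    rw [← AddCircle.coe_nsmul, ← AddCircle.coe_nsmul, sawtooth_coe, sawtooth_coe, mul_sub]
    simp only [nsmul_eq_mul, Nat.cast_pow]
    ring_nf
  rw [← hq] at hS ⊢
  simp only [hterm] at hS ⊢
  -- Adding the worst possible loss makes every term nonnegative, so the sum dominates its `m`-th
  -- term, which is at least `q ^ m`.
  have hnn : ∀ k : ℕ, 0 ≤ q ^ k * (realSawtooth N ((b ^ k * t - i / N) + b ^ k * s) -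
        realSawtooth N (b ^ k * t - i / N)) + q ^ k * min ((b : ℝ) ^ k * s) 1 := by
    intro k
    rw [← mul_add]
    refine mul_nonneg (by positivity) ?_
    linarith [realSawtooth_sub_ge hN1 (b ^ k * t - i / N) (s := b ^ k * s) (by positivity)]
  have hmain := (hS.add hsum).le_tsum m fun k _ => hnn k
  rw [hS.tsum_add hsum] at hmain
  have hrise : 1 - b ^ m * s ≤ realSawtooth N ((b ^ m * t - i / N) + b ^ m * s) -
        realSawtooth N (b ^ m * t - i / N) := by
    refine realSawtooth_sub_ge_of_mem hN2 (m := 0) ?_ ?_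
    · push_cast
      linarith
    · rw [add_div] at hi2
      push_cast
      linarith
  have hone : q ^ m ≤ q ^ m * (realSawtooth N ((b ^ m * t - i / N) + b ^ m * s) -
        realSawtooth N (b ^ m * t - i / N)) + q ^ m * min ((b : ℝ) ^ m * s) 1 := by
    rw [← mul_add]
    refine le_mul_of_one_le_right (by positivity) ?_
    rw [min_eq_left hy1]
    linarith
  have herr : s * (q * b) ^ (m + J) / (q * b - 1) + q ^ (m + J) / (1 - q) ≤ q ^ m * (1 / 2) := by
    calc s * (q * b) ^ (m + J) / (q * b - 1) + q ^ (m + J) / (1 - q)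
        = q ^ m * ((b ^ m * s) * (q * b) ^ J / (q * b - 1) + q ^ J / (1 - q)) := by
          rw [pow_add, pow_add, mul_pow q (b : ℝ) m]
          ring
      _ ≤ q ^ m * ((b * (2 / N)) * (q * b) ^ J / (q * b - 1) + q ^ J / (1 - q)) := by gcongr
      _ = q ^ m * (2 * b * (q * b) ^ J / (q * b - 1) / N + q ^ J / (1 - q)) := by ring
      _ ≤ q ^ m * (1 / 2) := by
          gcongr
          linarith
  have hsα : s ^ α ≤ q ^ m := by
    rw [rpow_eq_pow_mul_rpow hb0 α hs0 m, ← hq]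
    exact mul_le_of_le_one_right (by positivity) (Real.rpow_le_one (by positivity) hy1 hα₀.le)
  linarith

theorem isBiHolder_of_coordinates {α : ℝ} {d : ℕ} {Φ : UnitAddCircle → Fin d → ℝ} {c : ℝ}
    (hc : 0 < c) (hlow : ∀ x y, x ≠ y → ∃ i, c * dist x y ^ α ≤ |Φ x i - Φ y i|)
    (hup : ∀ i, ∃ C : ℝ, 0 ≤ C ∧ ∀ x y, x ≠ y → |Φ x i - Φ y i| ≤ C * dist x y ^ α) :
    IsBiHolder α Φ := by
  choose C hC0 hC using hup
  have hsum : 0 ≤ ∑ i, C i := Finset.sum_nonneg fun i _ => hC0 i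
  -- The summand `1` keeps the upper constant positive even if all `C i` vanish.
  refine ⟨c, 1 + ∑ i, C i, hc, by linarith, fun x y hxy => ?_⟩
  have hd : 0 < dist x y ^ α := Real.rpow_pos_of_pos (dist_pos.2 hxy) α
  rw [le_div_iff₀ hd, div_le_iff₀ hd]
  constructor
  · obtain ⟨i, hi⟩ := hlow x y hxy
    exact hi.trans (norm_le_pi_norm (Φ x - Φ y) i)
  · rw [pi_norm_le_iff_of_nonneg (by positivity)]
    intro i
    refine (hC i x y hxy).trans ?_
    gcongr
    linarith [Finset.single_le_sum (fun j _ => hC0 j) (Finset.mem_univ i)]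

/-- The grid point closest to `x` separates `x` from every point at distance at least `2 / N`. -/
theorem exists_grid_dist_sub_ge {N : ℕ} (hN : 0 < N) (x y : UnitAddCircle)
    (h : 2 / N ≤ dist x y) :
    ∃ j : Fin N, 1 / N ≤ |dist x ((j / N : ℝ) : UnitAddCircle) -
      dist y ((j / N : ℝ) : UnitAddCircle)| := by
  have hN' : (0 : ℝ) < N := by exact_mod_cast hN
  obtain ⟨t, rfl⟩ := QuotientAddGroup.mk_surjective x
  change 2 / N ≤ dist (t : UnitAddCircle) y at h
  change ∃ j : Fin N, 1 / N ≤ |dist (t : UnitAddCircle) ((j / N : ℝ) : UnitAddCircle) -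
      dist y ((j / N : ℝ) : UnitAddCircle)|
  set i : ℤ := round (t * N) with hi
  have hmod0 : 0 ≤ i % N := Int.emod_nonneg _ (by exact_mod_cast hN.ne')
  have hmod1 : i % N < N := Int.emod_lt_of_pos _ (by exact_mod_cast hN)
  set j : Fin N := ⟨(i % N).toNat, by lia⟩ with hj
  have hji : ((j : ℕ) : ℝ) = ((i % N : ℤ) : ℝ) := by
    rw [← Int.cast_natCast, hj]
    simp only [Int.toNat_of_nonneg hmod0]
  refine ⟨j, ?_⟩
  have hcoe : ((j / N : ℝ) : UnitAddCircle) = ((i / N : ℝ) : UnitAddCircle) := by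
    have e : (i : ℝ) / N = ((i % N : ℤ) : ℝ) / N + ((i / N : ℤ) : ℝ) := by
      have : ((i % N + N * (i / N) : ℤ) : ℝ) = i := by rw [Int.emod_add_mul_ediv]
      push_cast at this
      rw [← this]
      field_simp
    have hz : (((i / N : ℤ) : ℝ) : UnitAddCircle) = 0 := by
      rw [AddCircle.coe_eq_zero_iff]
      exact ⟨i / N, by simp⟩
    rw [hji, e, AddCircle.coe_add, hz, add_zero]
  rw [hcoe]
  -- Rounding costs at most `1 / (2N)`, so the other point stays at distance at least `3 / (2N)`
  -- from the grid point.
  have h1 : dist (t : UnitAddCircle) ((i / N : ℝ) : UnitAddCircle) ≤ 1 / 2 / N := by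
    rw [dist_eq_norm, ← AddCircle.coe_sub]
    refine (QuotientAddGroup.norm_mk_le_norm).trans ?_
    rw [Real.norm_eq_abs, le_div_iff₀ hN', ← abs_of_pos hN', ← abs_mul, abs_of_pos hN', sub_mul,
      div_mul_cancel₀ _ hN'.ne']
    exact abs_sub_round _
  have h2 := dist_triangle_right (t : UnitAddCircle) y ((i / N : ℝ) : UnitAddCircle)
  rw [abs_sub_comm]
  refine le_trans ?_ (le_abs_self _)
  have e2 : (2 : ℝ) / N = 2 * (1 / N) := by ring
  have e3 : (1 : ℝ) / 2 / N = 1 / 2 * (1 / N) := by ring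
  linarith

theorem exists_isBiHolder_weierstrassEmbedding {b : ℕ} (hb : 2 ≤ b) {α : ℝ} (hα₀ : 0 < α)
    (hα₁ : α < 1) :
    ∃ (d : ℕ) (G : Fin d → UnitAddCircle → ℝ),
      (∀ i, IsLipschitzOnCircle (G i)) ∧ IsBiHolder α (weierstrassEmbedding α b G) := by
  have hb0 : (0 : ℝ) < b := by positivity
  set q : ℝ := (b : ℝ) ^ (-α) with hq
  have hq0 : 0 < q := Real.rpow_pos_of_pos hb0 _
  have hq1 : q < 1 := rpow_neg_lt_one hb hα₀
  have hp : 1 < q * b := one_lt_rpow_neg_mul hb hα₁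
  obtain ⟨J, hJ⟩ : ∃ J : ℕ, q ^ J / (1 - q) ≤ 1 / 4 := by
    have h1 : 0 < 1 - q := by linarith
    obtain ⟨J, hJ⟩ := exists_pow_lt_of_lt_one (show 0 < 1 / 4 * (1 - q) by positivity) hq1
    exact ⟨J, (div_le_iff₀ h1).2 hJ.le⟩
  set A : ℝ := 2 * b * (q * b) ^ J / (q * b - 1) with hA
  -- `J` controls the high-frequency tail and is fixed first, since `A` depends on it; `N` then
  -- absorbs `A`, and the extra `2 * b` keeps the selected scale below `1`.
  obtain ⟨n, hn⟩ := exists_nat_ge (4 * A)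
  set N : ℕ := n + 2 * b with hNdef
  have hN0 : 0 < N := by lia
  have hN0' : (0 : ℝ) < N := by exact_mod_cast hN0
  have hNA : A / N ≤ 1 / 4 := by
    rw [div_le_iff₀ hN0']
    have : (n : ℝ) ≤ N := by exact_mod_cast (by lia : n ≤ N)
    linarith
  set h : Fin N → UnitAddCircle → ℝ := fun j x => dist x ((j / N : ℝ) : UnitAddCircle) with hh
  have hhL : ∀ j, IsLipschitzOnCircle (h j) := fun j => ⟨1, LipschitzWith.dist_left _⟩
  have hhW : ∀ j, weierstrass α b (fun x => h j x - q * h j (b • x)) = h j := fun j =>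
    (lipschitz_bounded (hhL j)).elim fun M hM => weierstrass_sub_smul hb hα₀ hM
  set G : Fin (N + N) → UnitAddCircle → ℝ :=
    Fin.append (fun j : Fin N => sawtooth N j) (fun j x => h j x - q * h j (b • x)) with hG
  have hGL : ∀ i, IsLipschitzOnCircle (G i) := by
    intro i
    induction i using Fin.addCases with
    | left j =>
      rw [hG, Fin.append_left]
      exact isLipschitzOnCircle_sawtooth hN0 _
    | right j =>
      rw [hG, Fin.append_right]
      exact isLipschitzOnCircle_sub_smul (hhL j) q b
  refine ⟨N + N, G, hGL, isBiHolder_of_coordinates (c := min (1 / 2) (1 / N)) (by positivity) ?_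
    fun i => exists_holder_weierstrass hb hα₀ hα₁ (hGL i)⟩
  intro x y hxy
  have hd : 0 < dist x y := dist_pos.2 hxy
  have hdα : 0 < dist x y ^ α := Real.rpow_pos_of_pos hd α
  rcases le_total (2 / (N : ℝ)) (dist x y) with hlarge | hsmall
  · obtain ⟨j, hj⟩ := exists_grid_dist_sub_ge hN0 x y hlarge
    refine ⟨Fin.natAdd N j, ?_⟩
    rw [weierstrassEmbedding, weierstrassEmbedding, hG, Fin.append_right, hhW j]
    refine le_trans ?_ hj
    calc min (1 / 2) (1 / (N : ℝ)) * dist x y ^ α ≤ 1 / N * 1 := by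
          gcongr
          · exact min_le_right _ _
          · exact Real.rpow_le_one hd.le (circle_dist_le_one x y) hα₀.le
      _ = 1 / N := mul_one _
  · obtain ⟨t, s, hs, hts⟩ := exists_lift_interval x y
    obtain ⟨i, hi⟩ := weierstrass_sawtooth_sub_ge hb hα₀ hα₁ (by lia) hJ hNA t
      (hs ▸ hd) (hs ▸ hsmall)
    have hmod0 : 0 ≤ i % N := Int.emod_nonneg _ (by exact_mod_cast hN0.ne')
    have hmod1 : i % N < N := Int.emod_lt_of_pos _ (by exact_mod_cast hN0)
    refine ⟨Fin.castAdd N ⟨(i % N).toNat, by lia⟩, ?_⟩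
    rw [weierstrassEmbedding, weierstrassEmbedding, hG, Fin.append_left]
    simp only [Int.toNat_of_nonneg hmod0]
    rw [sawtooth_emod hN0.ne']
    have hmin : min (1 / 2) (1 / (N : ℝ)) * dist x y ^ α ≤ s ^ α / 2 := by
      rw [← hs] at hdα ⊢
      refine (mul_le_mul_of_nonneg_right (min_le_left _ _) hdα.le).trans (le_of_eq ?_)
      ring
    refine hmin.trans (hi.trans ?_)
    rcases hts with ⟨rfl, rfl⟩ | ⟨rfl, rfl⟩
    · rw [abs_sub_comm]
      exact le_abs_self _
    · exact le_abs_self _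

theorem theorem3p1 (b : ℕ) (hb : 2 ≤ b) (α : ℝ) (hα₀ : 0 < α) (hα₁ : α < 1) :
    (∃ (d : ℕ) (G : Fin d → UnitAddCircle → ℝ),
        (∀ i, IsLipschitzOnCircle (G i)) ∧ IsBiHolder α (weierstrassEmbedding α b G)) ∧
    (∀ (d : ℕ) (G : Fin d → UnitAddCircle → ℝ),
        (∀ i, IsLipschitzOnCircle (G i)) → IsBiHolder α (weierstrassEmbedding α b G) →
        ∀ W ∈ weierstrassFamily α b,
          ∀ᵐ t : Fin d → ℝ ∂MeasureTheory.volume,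
            IsACWithL2Density
              (occupationMeasure (perturbed W (weierstrassEmbedding α b G) t))) := by
  refine ⟨exists_isBiHolder_weierstrassEmbedding hb hα₀ hα₁, ?_⟩
  rintro d G hG hbi W ⟨g, hg, rfl⟩
  exact ae_isACWithL2Density hα₀ hα₁ (continuous_weierstrass hb hα₀ hg)
    (continuous_pi fun i => continuous_weierstrass hb hα₀ (hG i)) hbi
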